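/- All matroids are on finite sets, and $M(A)$ denotes a matroid with ground set $A$. For a matroid $L(E)$ and $B\subseteq E$, write $L|B$ for the restriction of $L$ to $B$, and $L.B$ for the contraction of $L$ to $B$, obtained by contracting all elements of $E-B$. If $A\cup B=E$, $M=L|A$ and $N=L.B$, the free splice of $M$ and $N$ is the matroid on $E$ with rank function $$X\mapsto\min\{\,r_M(X\cap A)+|X-A|,\; r_N(X\cap B)+r_M(A-B)\,\};$$ that is, the Higgs lift of order $r_M(A-B)$ of $N$ with the elements of $A-B$ added as loops, towards $M$ with the elements of $B-A$ added as isthmuses. The pair $(A,B)$ is a free separator of $L$ if $L$ equals this free splice, and it is nontrivial if $A-B$ and $B-A$ are both nonempty. A matroid is irreducible if it has no nontrivial free separator. Let $M(A)$ and $N(B)$ be matroids, and set $T=A\cap B$. Suppose that $M|T=N|T=K$, that the closure $\mathrm{cl}_M(T)$ is a modular flat of $M$, and that each element of $\mathrm{cl}_M(T)-T$ is a loop of $M$ or is parallel in $M$ to an element of $T$. Then $M$ and $N$ have a freest amalgam: among the matroids on $A\cup B$ whose restrictions to $A$ and $B$ are $M$ and $N$, there is one whose independent sets include those of all the others. It is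 called the generalized parallel connection $P_K(M,N)$; its flats are the sets $F\subseteq A\cup B$ such that $F\cap A$ is a flat of $M$ and $F\cap B$ is a flat of $N$. **Proposition.** Let $M(A)$ and $N(B)$ be matroids with $|A|,|B|\ge 2$. 1. If $P_K(M,N)$ is defined (that is, the conditions above hold) and $M$ and $N$ are both irreducible, then $P_K(M,N)$ is irreducible. 2. If $A\cap B=\emptyset$, then the direct sum $M\oplus N$ is irreducible if and only if $M$ and $N$ are both irreducible. -/

import Mathlib

open Set

namespace Matroid

/-! ### Free splices, free separators, irreducible matroids -/

/-- The contraction of `L` to `B`, written `L.B`: contract every element outside `B`. -/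
def contractTo {α : Type*} (L : Matroid α) (B : Set α) : Matroid α :=
  L.contract (L.E \ B)

/-- Adjoin to `M` the elements of `S` that are not in its ground set, as isthmuses:
the direct sum of `M` with the free matroid on `S \ M.E`. -/
def adjoinIsthmuses {α : Type*} (M : Matroid α) (S : Set α) : Matroid α :=
  M.disjointSum (freeOn (S \ M.E)) (by rw [freeOn_ground]; exact disjoint_sdiff_right)

/-- Adjoin to `N` the elements of `S` that are not in its ground set, as loops:
the direct sum of `N` with the rank-zero matroid on `S \ N.E`. -/
def adjoinLoops {α : Type*} (N : Matroid α) (S : Set α) : Matroid α :=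
  N.disjointSum (loopyOn (S \ N.E)) (by rw [loopyOn_ground]; exact disjoint_sdiff_right)

/-- `L` is the `i`-th Higgs lift of `N` towards `M` (where `M`, `N` have the same ground set):
the matroid on that ground set with rank function `X ↦ min (r_M X) (i + r_N X)`.
A matroid is determined by its ground set and rank function, so there is at most one such `L`. -/
structure IsHiggsLift {α : Type*} (L : Matroid α) (i : ℕ∞) (N M : Matroid α) : Prop where
  ground_eq_left : M.E = L.E
  ground_eq_right : N.E = L.E
  eRk_eq : ∀ X ⊆ L.E, L.eRk X = min (M.eRk X) (i + N.eRk X)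

/-- `L` is the free splice of `M = M(A)` and `N = N(B)`: the Higgs lift of order `r_M (A \ B)` of
`N` (with the elements of `A \ B` adjoined as loops) towards `M` (with the elements of `B \ A`
adjoined as isthmuses). -/
def IsFreeSplice {α : Type*} (L M N : Matroid α) : Prop :=
  L.IsHiggsLift (M.eRk (M.E \ N.E)) (N.adjoinLoops M.E) (M.adjoinIsthmuses N.E)

/-- `(A, B)` is a free separator of `L(E)`: `A ∪ B = E` and `L` is the free splice of the
restriction `L|A` and the contraction `L.B`.  (These two matroids always agree on `A ∩ B` in the
sense required of a pair of matroids that has splices.) -/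
def IsFreeSeparator {α : Type*} (L : Matroid α) (A B : Set α) : Prop :=
  A ∪ B = L.E ∧ L.IsFreeSplice (L.restrict A) (L.contractTo B)

/-- `L` is reducible if it has a free separator `(A, B)` with `A \ B` and `B \ A` nonempty. -/
def IsReducible {α : Type*} (L : Matroid α) : Prop :=
  ∃ A B : Set α, L.IsFreeSeparator A B ∧ (A \ B).Nonempty ∧ (B \ A).Nonempty

/-- `L` is irreducible with respect to free splice. -/
def IsIrreducible {α : Type*} (L : Matroid α) : Prop :=
  ¬ L.IsReducible

/-! ### Amalgams and the generalized parallel connection -/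

/-- `P` is an amalgam of `M(A)` and `N(B)`: a matroid on `A ∪ B` that restricts to both. -/
structure IsAmalgam {α : Type*} (P M N : Matroid α) : Prop where
  ground_eq : P.E = M.E ∪ N.E
  restrict_left : P.restrict M.E = M
  restrict_right : P.restrict N.E = N

/-- `P` is the freest amalgam of `M` and `N`: the maximum of their amalgams in the weak order. -/
structure IsFreestAmalgam {α : Type*} (P M N : Matroid α) : Prop where
  isAmalgam : P.IsAmalgam M N
  freest : ∀ Q : Matroid α, Q.IsAmalgam M N → ∀ I, Q.Indep I → P.Indep I

/-- `F` is a modular flat of `M`: it forms a modular pair with every flat. -/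
structure IsModularFlat {α : Type*} (M : Matroid α) (F : Set α) : Prop where
  isFlat : M.IsFlat F
  modular : ∀ G, M.IsFlat G → M.eRk F + M.eRk G = M.eRk (F ∪ G) + M.eRk (F ∩ G)

/-- The conditions under which the generalized parallel connection of `M(A)` and `N(B)` is
defined.  With `T = A ∩ B`: `M|T = N|T`, the closure of `T` in `M` is a modular flat of `M`, and
each element of this closure outside `T` is a loop of `M` or is parallel to an element of `T`. -/
structure GPCDefined {α : Type*} (M N : Matroid α) : Prop where
  restrict_eq : M.restrict (M.E ∩ N.E) = N.restrict (M.E ∩ N.E)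
  modular : M.IsModularFlat (M.closure (M.E ∩ N.E))
  loop_or_parallel : ∀ e ∈ M.closure (M.E ∩ N.E) \ (M.E ∩ N.E),
    M.IsLoop e ∨ ∃ f ∈ M.E ∩ N.E, M.IsCircuit {e, f}

/-! #### A matroid on a finite set from its family of flats -/

section OfFlats

variable {α : Type*}

/-- The intersection of all members of `𝓕` that contain `X`. -/
def famClosure (𝓕 : Set α → Prop) (X : Set α) : Set α := {e | ∀ F, 𝓕 F → X ⊆ F → e ∈ F}

theorem subset_famClosure (𝓕 : Set α → Prop) (X : Set α) : X ⊆ famClosure 𝓕 X :=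
  fun _ he _ _ h => h he

theorem famClosure_subset {𝓕 : Set α → Prop} {X F : Set α} (hF : 𝓕 F) (h : X ⊆ F) :
    famClosure 𝓕 X ⊆ F := fun _ he => he F hF h

theorem famClosure_mono (𝓕 : Set α → Prop) {X Y : Set α} (h : X ⊆ Y) :
    famClosure 𝓕 X ⊆ famClosure 𝓕 Y := fun _ he F hF hY => he F hF (h.trans hY)

theorem famClosure_le (𝓕 : Set α → Prop) {X Y : Set α} (h : X ⊆ famClosure 𝓕 Y) :
    famClosure 𝓕 X ⊆ famClosure 𝓕 Y :=
  fun _ he F hF hY => he F hF (h.trans (famClosure_subset hF hY))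

/-- Axioms for the family of flats of a matroid on the finite set `E`. -/
structure FlatAxioms (E : Set α) (𝓕 : Set α → Prop) : Prop where
  finite : E.Finite
  ground : 𝓕 E
  subset_ground : ∀ F, 𝓕 F → F ⊆ E
  closed : ∀ X ⊆ E, 𝓕 (famClosure 𝓕 X)
  exchange : ∀ F, 𝓕 F → ∀ e ∉ F, ∀ f ∈ E,
    e ∈ famClosure 𝓕 (insert f F) → f ∈ famClosure 𝓕 (insert e F)

/-- Independence with respect to a family of flats. -/
def famIndep (E : Set α) (𝓕 : Set α → Prop) (I : Set α) : Prop :=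
  I ⊆ E ∧ ∀ e ∈ I, e ∉ famClosure 𝓕 (I \ {e})

theorem FlatAxioms.exchange' {E : Set α} {𝓕 : Set α → Prop} (h : FlatAxioms E 𝓕) {X : Set α}
    {e f : α} (hX : X ⊆ E) (hf : f ∈ E) (he : e ∉ famClosure 𝓕 X)
    (hef : e ∈ famClosure 𝓕 (insert f X)) : f ∈ famClosure 𝓕 (insert e X) := by
  have h1 := h.exchange _ (h.closed X hX) e he f hf
    (famClosure_mono _ (insert_subset_insert (subset_famClosure _ _)) hef)
  refine famClosure_le _ ?_ h1
  exact insert_subset (subset_famClosure _ _ (mem_insert _ _))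
    (famClosure_mono _ (subset_insert _ _))

theorem FlatAxioms.indep_insert {E : Set α} {𝓕 : Set α → Prop} (h : FlatAxioms E 𝓕) {I : Set α}
    {x : α} (hI : famIndep E 𝓕 I) (hx : x ∈ E) (hxI : x ∉ famClosure 𝓕 I) :
    famIndep E 𝓕 (insert x I) := by
  have hxI' : x ∉ I := fun h' => hxI (subset_famClosure _ _ h')
  refine ⟨insert_subset hx hI.1, ?_⟩
  rintro e (rfl | he) hcl
  · rw [insert_sdiff_self_of_notMem hxI'] at hcl
    exact hxI hcl
  · have hne : x ≠ e := fun h' => hxI' (h' ▸ he)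
    rw [← insert_sdiff_singleton_comm hne] at hcl
    have := h.exchange' (sdiff_subset.trans hI.1) hx (hI.2 e he) hcl
    rw [insert_sdiff_singleton, insert_eq_of_mem he] at this
    exact hxI this

/-- The matroid on `E` whose flats are the members of `𝓕`. -/
def ofFlats (E : Set α) (𝓕 : Set α → Prop) (h : FlatAxioms E 𝓕) : Matroid α :=
  (IndepMatroid.ofBdd E (famIndep E 𝓕) ⟨empty_subset _, fun _ he => he.elim⟩
    (fun _ _ hJ hIJ => ⟨hIJ.trans hJ.1, fun e he hcl =>
      hJ.2 e (hIJ he) (famClosure_mono _ (sdiff_subset_sdiff_left hIJ) hcl)⟩)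
    (by
      intro I B hI hImax hB
      by_contra! hcon
      have hBI : B ⊆ famClosure 𝓕 I := by
        intro x hx
        by_contra hxI
        exact hcon x ⟨hx, fun h' => hxI (subset_famClosure _ _ h')⟩
          (h.indep_insert hI (hB.prop.1 hx) hxI)
      have hEB : E ⊆ famClosure 𝓕 B := by
        intro x hx
        by_contra hxB
        exact hxB (subset_famClosure _ _
          (hB.le_of_ge (h.indep_insert hB.prop hx hxB) (subset_insert _ _) (mem_insert _ _)))
      refine hImax ⟨hI, fun J hJ hIJ x hx => ?_⟩
      by_contra hxI
      have hx1 : x ∈ famClosure 𝓕 I := famClosure_le _ hBI (hEB (hJ.1 hx))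
      exact hJ.2 x hx (famClosure_mono _ (subset_sdiff_singleton hIJ hxI) hx1))
    (fun _ hI => hI.1)
    ⟨E.ncard, fun I hI => by
      rw [h.finite.cast_ncard_eq]; exact encard_le_encard hI.1⟩).matroid

@[simp] theorem ofFlats_ground (E : Set α) (𝓕 : Set α → Prop) (h : FlatAxioms E 𝓕) :
    (ofFlats E 𝓕 h).E = E := rfl

theorem ofFlats_indep_iff {E : Set α} {𝓕 : Set α → Prop} {h : FlatAxioms E 𝓕} {I : Set α} :
    (ofFlats E 𝓕 h).Indep I ↔ famIndep E 𝓕 I := Iff.rfl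

theorem ofFlats_closure {E : Set α} {𝓕 : Set α → Prop} (h : FlatAxioms E 𝓕) {X : Set α}
    (hX : X ⊆ E) : (ofFlats E 𝓕 h).closure X = famClosure 𝓕 X := by
  have key : ∀ I, (ofFlats E 𝓕 h).Indep I →
      (ofFlats E 𝓕 h).closure I = famClosure 𝓕 I := by
    intro I hI
    have hIE : I ⊆ E := hI.subset_ground
    ext e
    by_cases heI : e ∈ I
    · exact iff_of_true (mem_closure_of_mem _ heI hIE) (subset_famClosure _ _ heI)
    rw [hI.mem_closure_iff_of_notMem heI]
    constructor
    · intro hd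
      by_contra hcl
      exact hd.not_indep
        (h.indep_insert hI (hd.subset_ground (mem_insert _ _)) hcl)
    · intro hcl
      refine ⟨fun hi => ?_, insert_subset (famClosure_subset h.ground hIE hcl) hIE⟩
      have := hi.2 e (mem_insert _ _)
      rw [insert_sdiff_self_of_notMem heI] at this
      exact this hcl
  obtain ⟨I, hI⟩ := (ofFlats E 𝓕 h).exists_isBasis X hX
  rw [← hI.closure_eq_closure, key I hI.indep]
  refine (famClosure_mono _ hI.subset).antisymm (famClosure_le _ ?_)
  rw [← key I hI.indep]
  exact hI.subset_closure

theorem ofFlats_isFlat_iff {E : Set α} {𝓕 : Set α → Prop} (h : FlatAxioms E 𝓕) {F : Set α} :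
    (ofFlats E 𝓕 h).IsFlat F ↔ 𝓕 F := by
  rw [isFlat_iff_closure_eq]
  constructor
  · intro hF
    have hFE : F ⊆ E := by rw [← hF]; exact closure_subset_ground _ _
    rw [ofFlats_closure h hFE] at hF
    rw [← hF]
    exact h.closed F hFE
  · intro hF
    rw [ofFlats_closure h (h.subset_ground F hF)]
    exact (famClosure_subset hF Subset.rfl).antisymm (subset_famClosure _ _)

end OfFlats

/-! #### Existence of the generalized parallel connection -/

section GPC

variable {α : Type*} {M N : Matroid α}

/-- Modularity of `T = A ∩ B`. -/
theorem GPCDefined.eRk_add (h : GPCDefined M N) {G : Set α} (hG : M.IsFlat G) :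
    M.eRk (M.E ∩ N.E) + M.eRk G = M.eRk (G ∪ (M.E ∩ N.E)) + M.eRk (G ∩ (M.E ∩ N.E)) := by
  set T := M.E ∩ N.E with hT
  have h1 := h.modular.modular G hG
  have h2 : M.eRk (M.closure T ∪ G) = M.eRk (G ∪ T) := by
    rw [← M.eRk_closure_eq (M.closure T ∪ G), closure_union_closure_left_eq,
      M.eRk_closure_eq, union_comm]
  have h3 : M.closure (M.closure T ∩ G) = M.closure (G ∩ T) := by
    refine (closure_subset_closure_of_subset_closure ?_).antisymm
      (closure_subset_closure _ ?_)
    · rintro e ⟨he, heG⟩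
      by_cases heT : e ∈ T
      · exact M.mem_closure_of_mem' ⟨heG, heT⟩ heT.1
      rcases h.loop_or_parallel e ⟨he, heT⟩ with hl | ⟨f, hf, hc⟩
      · exact hl.mem_closure _
      · have hef : e ≠ f := fun h' => heT (h' ▸ hf)
        have hfe : f ∈ M.closure {e} := by
          have := hc.mem_closure_sdiff_singleton_of_mem (e := f) (by simp)
          rwa [show ({e, f} : Set α) \ {f} = {e} by ext; grind] at this
        have hef' : e ∈ M.closure {f} := by
          have := hc.mem_closure_sdiff_singleton_of_mem (e := e) (by simp)
          rwa [show ({e, f} : Set α) \ {e} = {f} by ext; grind] at this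
        have hfG : f ∈ G := by
          rw [← hG.closure]
          exact M.closure_subset_closure (singleton_subset_iff.2 heG) hfe
        have hsub : ({f} : Set α) ⊆ G ∩ T := singleton_subset_iff.2 ⟨hfG, hf⟩
        exact M.closure_subset_closure hsub hef'
    · exact fun e he => ⟨M.mem_closure_of_mem' he.2 he.2.1, he.1⟩
  rw [M.eRk_closure_eq, h2, ← M.eRk_closure_eq (M.closure T ∩ G), h3, M.eRk_closure_eq] at h1
  exact h1

theorem exists_eRk_eq [M.Finite] (X : Set α) : ∃ n : ℕ, M.eRk X = n :=
  ENat.ne_top_iff_exists.1 (M.isRkFinite_set X).eRk_lt_top.ne |>.imp fun _ h => h.symm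

/-- Two nested flats that agree on `T` and have the same join with `T` are equal. -/
theorem GPCDefined.eq_of_flats [M.Finite] (h : GPCDefined M N) {F D : Set α} (hF : M.IsFlat F)
    (hD : M.IsFlat D) (hFD : F ⊆ D) (hT : D ∩ (M.E ∩ N.E) = F ∩ (M.E ∩ N.E))
    (hDF : D ⊆ M.closure (F ∪ (M.E ∩ N.E))) : D = F := by
  have h1 := h.eRk_add hF
  have h2 := h.eRk_add hD
  rw [hT] at h2
  have h3 : M.eRk (D ∪ (M.E ∩ N.E)) = M.eRk (F ∪ (M.E ∩ N.E)) := by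
    refine le_antisymm ?_ (M.eRk_mono (union_subset_union_left _ hFD))
    rw [← M.eRk_closure_eq (F ∪ (M.E ∩ N.E))]
    refine M.eRk_mono (union_subset hDF ?_)
    exact M.subset_closure_of_subset' subset_union_right inter_subset_left
  rw [h3, ← h1] at h2
  have h4 : M.eRk D = M.eRk F := by
    obtain ⟨a, ha⟩ := M.exists_eRk_eq (M.E ∩ N.E)
    obtain ⟨b, hb⟩ := M.exists_eRk_eq D
    obtain ⟨c, hc⟩ := M.exists_eRk_eq F
    rw [ha, hb, hc] at h2
    rw [hb, hc]
    norm_cast at h2 ⊢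
    omega
  have := (M.isRkFinite_set F).closure_eq_closure_of_subset_of_eRk_ge_eRk hFD h4.le
  rw [hF.closure, hD.closure] at this
  exact this.symm

theorem GPCDefined.closure_inter [M.Finite] (h : GPCDefined M N) {F S : Set α} (hF : M.IsFlat F)
    (hFS : F ∩ (M.E ∩ N.E) ⊆ S) (hST : S ⊆ M.E ∩ N.E)
    (hS : M.closure S ∩ (M.E ∩ N.E) ⊆ S) :
    M.closure (F ∪ S) ∩ (M.E ∩ N.E) = S := by
  set T := M.E ∩ N.E with hT
  have hSE : S ⊆ M.E := hST.trans inter_subset_left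
  have hsub : S ⊆ M.closure (F ∪ S) ∩ T :=
    subset_inter (M.subset_closure_of_subset' subset_union_right hSE) hST
  refine Subset.antisymm ?_ hsub
  have h1 := h.eRk_add hF
  have h2 := h.eRk_add (M.isFlat_closure (F ∪ S))
  have h3 : M.eRk (M.closure (F ∪ S) ∪ T) = M.eRk (F ∪ T) := by
    rw [← M.eRk_closure_eq, closure_union_closure_left_eq, M.eRk_closure_eq, union_assoc,
      union_eq_self_of_subset_left hST]
  have h4 := M.eRk_submod F S
  have hFS' : F ∩ S = F ∩ T := by
    ext e
    exact ⟨fun he => ⟨he.1, hST he.2⟩, fun he => ⟨he.1, hFS he⟩⟩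
  have h5 : M.eRk (M.closure (F ∪ S) ∩ T) ≤ M.eRk S := by
    rw [← hT] at h1 h2
    rw [h3, M.eRk_closure_eq] at h2
    rw [hFS'] at h4
    obtain ⟨a, ha⟩ := M.exists_eRk_eq T
    obtain ⟨b, hb⟩ := M.exists_eRk_eq F
    obtain ⟨c, hc⟩ := M.exists_eRk_eq S
    obtain ⟨d, hd⟩ := M.exists_eRk_eq (F ∪ T)
    obtain ⟨e, he⟩ := M.exists_eRk_eq (F ∩ T)
    obtain ⟨f, hf⟩ := M.exists_eRk_eq (F ∪ S)
    obtain ⟨g, hg⟩ := M.exists_eRk_eq (M.closure (F ∪ S) ∩ T)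
    rw [ha, hb, hd, he] at h1
    rw [ha, hf, hd, hg] at h2
    rw [he, hf, hb, hc] at h4
    rw [hg, hc]
    norm_cast at h1 h2 h4 ⊢
    omega
  have h6 := (M.isRkFinite_set S).closure_eq_closure_of_subset_of_eRk_ge_eRk hsub h5
  intro e he
  refine hS ⟨?_, he.2⟩
  rw [h6]
  exact M.mem_closure_of_mem' he he.2.1

theorem GPCDefined.closure_eq (h : GPCDefined M N) {S : Set α} (hS : S ⊆ M.E ∩ N.E) :
    M.closure S ∩ (M.E ∩ N.E) = N.closure S ∩ (M.E ∩ N.E) := by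
  have h1 := congr_arg (fun K : Matroid α => K.closure S) h.restrict_eq
  simp only [restrict_closure_eq', inter_eq_self_of_subset_left hS] at h1
  rwa [sdiff_eq_empty.2 inter_subset_left, sdiff_eq_empty.2 inter_subset_right, union_empty,
    union_empty] at h1

/-- The family of flats of the generalized parallel connection. -/
def gpcFlat (M N : Matroid α) (F : Set α) : Prop :=
  F ⊆ M.E ∪ N.E ∧ M.IsFlat (F ∩ M.E) ∧ N.IsFlat (F ∩ N.E)

theorem gpcFlat_ground (M N : Matroid α) : gpcFlat M N (M.E ∪ N.E) := by
  refine ⟨Subset.rfl, ?_, ?_⟩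
  · rw [inter_eq_self_of_subset_right subset_union_left]
    exact M.ground_isFlat
  · rw [inter_eq_self_of_subset_right subset_union_right]
    exact N.ground_isFlat

theorem gpcFlat_union {G H : Set α} (hG : M.IsFlat G) (hH : N.IsFlat H)
    (h : G ∩ (M.E ∩ N.E) = H ∩ (M.E ∩ N.E)) :
    gpcFlat M N (G ∪ H) ∧ (G ∪ H) ∩ M.E = G ∧ (G ∪ H) ∩ N.E = H := by
  have hGE := hG.subset_ground
  have hHE := hH.subset_ground
  have e1 : (G ∪ H) ∩ M.E = G := by
    ext x
    have := Set.ext_iff.1 h x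
    simp only [mem_inter_iff, mem_union] at this ⊢
    grind
  have e2 : (G ∪ H) ∩ N.E = H := by
    ext x
    have := Set.ext_iff.1 h x
    simp only [mem_inter_iff, mem_union] at this ⊢
    grind
  exact ⟨⟨union_subset_union hGE hHE, e1.symm ▸ hG, e2.symm ▸ hH⟩, e1, e2⟩

theorem mem_famClosure_left {F : Set α} {e f : α} (h : f ∈ M.closure (insert e (F ∩ M.E))) :
    f ∈ famClosure (gpcFlat M N) (insert e F) := by
  rintro G ⟨_, hG, _⟩ hsub
  have : insert e (F ∩ M.E) ∩ M.E ⊆ G ∩ M.E :=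
    inter_subset_inter_left _ ((insert_subset_insert inter_subset_left).trans hsub)
  rw [← closure_inter_ground] at h
  have h' := M.closure_subset_closure this h
  rw [hG.closure] at h'
  exact h'.1

theorem mem_famClosure_right {F : Set α} {e f : α} (h : f ∈ N.closure (insert e (F ∩ N.E))) :
    f ∈ famClosure (gpcFlat M N) (insert e F) := by
  rintro G ⟨_, _, hG⟩ hsub
  have : insert e (F ∩ N.E) ∩ N.E ⊆ G ∩ N.E :=
    inter_subset_inter_left _ ((insert_subset_insert inter_subset_left).trans hsub)
  rw [← closure_inter_ground] at h
  have h' := N.closure_subset_closure this h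
  rw [hG.closure] at h'
  exact h'.1

theorem famClosure_insert_trans {𝓕 : Set α → Prop} {F : Set α} {e p f : α}
    (h1 : p ∈ famClosure 𝓕 (insert e F)) (h2 : f ∈ famClosure 𝓕 (insert p F)) :
    f ∈ famClosure 𝓕 (insert e F) :=
  famClosure_le _ (insert_subset h1 ((subset_insert _ _).trans (subset_famClosure _ _))) h2

theorem GPCDefined.exchange_right [M.Finite] (h : GPCDefined M N) {F : Set α}
    (hF : gpcFlat M N F) {e f : α} (he : e ∉ F) (hf : f ∈ N.E)
    (hef : e ∈ famClosure (gpcFlat M N) (insert f F)) :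
    f ∈ famClosure (gpcFlat M N) (insert e F) := by
  obtain ⟨hFE, hFM, hFN⟩ := hF
  set T := M.E ∩ N.E with hT
  set H := N.closure (insert f (F ∩ N.E)) with hH
  have hins : insert f (F ∩ N.E) ⊆ N.E := insert_subset hf inter_subset_right
  have hsubH : insert f (F ∩ N.E) ⊆ H := N.subset_closure _ hins
  have hHfl : N.IsFlat H := N.isFlat_closure _
  have hNex : ∀ p ∈ H, p ∉ F → f ∈ famClosure (gpcFlat M N) (insert p F) := by
    intro p hp hpF
    refine mem_famClosure_right (closure_exchange ⟨hp, ?_⟩).1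
    rw [hFN.closure]
    exact fun h' => hpF h'.1
  have hFS : (F ∩ M.E) ∩ T ⊆ H ∩ T :=
    fun x hx => ⟨hsubH (mem_insert_of_mem _ ⟨hx.1.1, hx.2.2⟩), hx.2⟩
  have hScl : M.closure (H ∩ T) ∩ T ⊆ H ∩ T := by
    rw [h.closure_eq inter_subset_right]
    refine inter_subset_inter_left _ ?_
    exact (N.closure_subset_closure inter_subset_left).trans hHfl.closure.subset
  have hGT := h.closure_inter hFM hFS inter_subset_right hScl
  set G := M.closure ((F ∩ M.E) ∪ (H ∩ T)) with hG
  obtain ⟨hfl, -, -⟩ := gpcFlat_union (M.isFlat_closure _) hHfl (by rw [← hG, ← hT, hGT])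
  have heGH : e ∈ G ∪ H := by
    refine hef _ hfl (insert_subset (Or.inr (hsubH (mem_insert _ _))) ?_)
    intro x hx
    rcases hFE hx with hxM | hxN
    · exact Or.inl (M.mem_closure_of_mem' (Or.inl ⟨hx, hxM⟩) hxM)
    · exact Or.inr (hsubH (mem_insert_of_mem _ ⟨hx, hxN⟩))
  rcases heGH with heG | heH
  swap
  · exact hNex e heH he
  have heM : e ∈ M.E := M.mem_ground_of_mem_closure heG
  have hinsM : insert e (F ∩ M.E) ⊆ M.E := insert_subset heM inter_subset_right
  have hsubD : insert e (F ∩ M.E) ⊆ M.closure (insert e (F ∩ M.E)) := M.subset_closure _ hinsM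
  have hFMD : F ∩ M.E ⊆ M.closure (insert e (F ∩ M.E)) := (subset_insert _ _).trans hsubD
  have hDG : M.closure (insert e (F ∩ M.E)) ⊆ G := by
    refine closure_subset_closure_of_subset_closure (insert_subset heG ?_)
    exact M.subset_closure_of_subset' subset_union_left inter_subset_right
  by_cases hp : ∃ p ∈ M.closure (insert e (F ∩ M.E)) ∩ T, p ∉ F
  · obtain ⟨p, hpD, hpF⟩ := hp
    have hpH : p ∈ H := by
      have : p ∈ G ∩ T := ⟨hDG hpD.1, hpD.2⟩
      rw [hGT] at this
      exact this.1
    exact famClosure_insert_trans (mem_famClosure_left hpD.1) (hNex p hpH hpF)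
  · push Not at hp
    exfalso
    have hEq := h.eq_of_flats hFM (M.isFlat_closure (insert e (F ∩ M.E))) hFMD
      (Subset.antisymm (fun x hx => ⟨⟨hp x hx, hx.2.1⟩, hx.2⟩) (inter_subset_inter_left _ hFMD))
      (hDG.trans (M.closure_subset_closure (union_subset_union_right _ inter_subset_right)))
    have : e ∈ F ∩ M.E := by
      rw [← hEq]
      exact hsubD (mem_insert _ _)
    exact he this.1

theorem GPCDefined.exchange_left [M.Finite] (h : GPCDefined M N) {F : Set α}
    (hF : gpcFlat M N F) {e f : α} (he : e ∉ F) (hf : f ∈ M.E)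
    (hef : e ∈ famClosure (gpcFlat M N) (insert f F)) :
    f ∈ famClosure (gpcFlat M N) (insert e F) := by
  obtain ⟨hFE, hFM, hFN⟩ := hF
  have hins : insert f (F ∩ M.E) ⊆ M.E := insert_subset hf inter_subset_right
  have hsubG : insert f (F ∩ M.E) ⊆ M.closure (insert f (F ∩ M.E)) := M.subset_closure _ hins
  have hMex : ∀ p ∈ M.closure (insert f (F ∩ M.E)), p ∉ F →
      f ∈ famClosure (gpcFlat M N) (insert p F) := by
    intro p hp hpF
    refine mem_famClosure_left (closure_exchange ⟨hp, ?_⟩).1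
    rw [hFM.closure]
    exact fun h' => hpF h'.1
  by_cases hp : ∃ p ∈ M.closure (insert f (F ∩ M.E)) ∩ (M.E ∩ N.E), p ∉ F
  · obtain ⟨p, hpG, hpF⟩ := hp
    have h1 : p ∈ famClosure (gpcFlat M N) (insert e F) :=
      h.exchange_right ⟨hFE, hFM, hFN⟩ he hpG.2.2
        (famClosure_insert_trans (hMex p hpG.1 hpF) hef)
    exact famClosure_insert_trans h1 (hMex p hpG.1 hpF)
  · push Not at hp
    have hGF : M.closure (insert f (F ∩ M.E)) ∩ (M.E ∩ N.E) = (F ∩ N.E) ∩ (M.E ∩ N.E) :=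
      Subset.antisymm (fun x hx => ⟨⟨hp x hx, hx.2.2⟩, hx.2⟩)
        (fun x hx => ⟨hsubG (mem_insert_of_mem _ ⟨hx.1.1, hx.2.1⟩), hx.2⟩)
    obtain ⟨hfl, -, -⟩ := gpcFlat_union (M.isFlat_closure _) hFN hGF
    have := hef _ hfl (insert_subset (Or.inl (hsubG (mem_insert _ _))) fun x hx => by
      rcases hFE hx with hxM | hxN
      · exact Or.inl (hsubG (mem_insert_of_mem _ ⟨hx, hxM⟩))
      · exact Or.inr ⟨hx, hxN⟩)
    rcases this with heG | heF
    · exact hMex e heG he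
    · exact (he heF.1).elim

theorem GPCDefined.flatAxioms [M.Finite] [N.Finite] (h : GPCDefined M N) :
    FlatAxioms (M.E ∪ N.E) (gpcFlat M N) where
  finite := M.ground_finite.union N.ground_finite
  ground := gpcFlat_ground M N
  subset_ground F hF := hF.1
  closed X hX := by
    refine ⟨famClosure_subset (gpcFlat_ground M N) hX, ?_, ?_⟩
    · rw [isFlat_iff_closure_eq]
      refine Subset.antisymm (fun e he => ⟨?_, M.mem_ground_of_mem_closure he⟩)
        (M.subset_closure _ inter_subset_right)
      intro F hF hXF
      have h1 : famClosure (gpcFlat M N) X ∩ M.E ⊆ F ∩ M.E :=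
        inter_subset_inter_left _ (famClosure_subset hF hXF)
      have h2 := M.closure_subset_closure h1 he
      rw [hF.2.1.closure] at h2
      exact h2.1
    · rw [isFlat_iff_closure_eq]
      refine Subset.antisymm (fun e he => ⟨?_, N.mem_ground_of_mem_closure he⟩)
        (N.subset_closure _ inter_subset_right)
      intro F hF hXF
      have h1 : famClosure (gpcFlat M N) X ∩ N.E ⊆ F ∩ N.E :=
        inter_subset_inter_left _ (famClosure_subset hF hXF)
      have h2 := N.closure_subset_closure h1 he
      rw [hF.2.2.closure] at h2
      exact h2.1
  exchange F hF e he f hf hef := by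
    rcases hf with hfM | hfN
    · exact h.exchange_left hF he hfM hef
    · exact h.exchange_right hF he hfN hef

theorem GPCDefined.ofFlats_isAmalgam [M.Finite] [N.Finite] (h : GPCDefined M N) :
    (ofFlats _ _ h.flatAxioms).IsAmalgam M N := by
  refine ⟨rfl, ?_, ?_⟩
  · refine ext_closure fun X => ?_
    rw [restrict_closure_eq', ← closure_inter_ground M X]
    have hXE : X ∩ M.E ⊆ M.E ∪ N.E := inter_subset_right.trans subset_union_left
    rw [ofFlats_closure _ hXE, ofFlats_ground, sdiff_eq_empty.2 subset_union_left, union_empty]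
    have hfl := M.isFlat_closure (X ∩ M.E)
    obtain ⟨h1, h2, -⟩ := gpcFlat_union (N := N) hfl
      (N.isFlat_closure (M.closure (X ∩ M.E) ∩ (M.E ∩ N.E))) (by
        rw [← h.closure_eq inter_subset_right]
        refine Subset.antisymm (subset_inter ?_ inter_subset_right) (inter_subset_inter_left _ ?_)
        · exact M.subset_closure _ (inter_subset_right.trans inter_subset_left)
        · exact (M.closure_subset_closure inter_subset_left).trans hfl.closure.subset)
    refine Subset.antisymm ?_ (fun e he => ⟨?_, M.mem_ground_of_mem_closure he⟩)
    · rw [← h2]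
      refine inter_subset_inter_left _ (famClosure_subset h1 ?_)
      exact (M.subset_closure _ inter_subset_right).trans subset_union_left
    · intro F hF hXF
      have h3 := M.closure_subset_closure (subset_inter hXF inter_subset_right) he
      rw [hF.2.1.closure] at h3
      exact h3.1
  · refine ext_closure fun X => ?_
    rw [restrict_closure_eq', ← closure_inter_ground N X]
    have hXE : X ∩ N.E ⊆ M.E ∪ N.E := inter_subset_right.trans subset_union_right
    rw [ofFlats_closure _ hXE, ofFlats_ground, sdiff_eq_empty.2 subset_union_right, union_empty]
    have hfl := N.isFlat_closure (X ∩ N.E)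
    obtain ⟨h1, -, h2⟩ := gpcFlat_union (M := M)
      (M.isFlat_closure (N.closure (X ∩ N.E) ∩ (M.E ∩ N.E))) hfl (by
        rw [h.closure_eq inter_subset_right]
        refine Subset.antisymm (inter_subset_inter_left _ ?_) (subset_inter ?_ inter_subset_right)
        · exact (N.closure_subset_closure inter_subset_left).trans hfl.closure.subset
        · exact N.subset_closure _ (inter_subset_right.trans inter_subset_right))
    refine Subset.antisymm ?_ (fun e he => ⟨?_, N.mem_ground_of_mem_closure he⟩)
    · rw [← h2]
      refine inter_subset_inter_left _ (famClosure_subset h1 ?_)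
      exact (N.subset_closure _ inter_subset_right).trans subset_union_right
    · intro F hF hXF
      have h3 := N.closure_subset_closure (subset_inter hXF inter_subset_right) he
      rw [hF.2.2.closure] at h3
      exact h3.1

theorem IsFlat.inter_isFlat_restrict {P : Matroid α} {F R : Set α} (hF : P.IsFlat F)
    (hR : R ⊆ P.E) : (P.restrict R).IsFlat (F ∩ R) := by
  rw [isFlat_iff_closure_eq, restrict_closure_eq', sdiff_eq_empty.2 hR, union_empty]
  refine Subset.antisymm (subset_inter ?_ inter_subset_right) (subset_inter ?_ inter_subset_right)
  · refine inter_subset_left.trans ((P.closure_subset_closure ?_).trans hF.closure.subset)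
    exact inter_subset_left.trans inter_subset_left
  · rw [inter_assoc, inter_self]
    exact P.subset_closure _ (inter_subset_right.trans hR)

theorem GPCDefined.ofFlats_isFreestAmalgam [M.Finite] [N.Finite] (h : GPCDefined M N) :
    (ofFlats _ _ h.flatAxioms).IsFreestAmalgam M N := by
  refine ⟨h.ofFlats_isAmalgam, fun Q hQ I hI => ?_⟩
  have hIE : I ⊆ M.E ∪ N.E := hQ.ground_eq ▸ hI.subset_ground
  refine ofFlats_indep_iff.2 ⟨hIE, fun e he hcl => ?_⟩
  refine hI.notMem_closure_sdiff_of_mem he (hcl _ ⟨?_, ?_, ?_⟩ ?_)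
  · exact hQ.ground_eq ▸ Q.closure_subset_ground _
  · have := (Q.isFlat_closure (I \ {e})).inter_isFlat_restrict (R := M.E)
      (hQ.ground_eq ▸ subset_union_left)
    rwa [hQ.restrict_left] at this
  · have := (Q.isFlat_closure (I \ {e})).inter_isFlat_restrict (R := N.E)
      (hQ.ground_eq ▸ subset_union_right)
    rwa [hQ.restrict_right] at this
  · exact Q.subset_closure _ (sdiff_subset.trans hI.subset_ground)

/-- Whenever the conditions for the generalized parallel connection hold, `M` and `N` have a
freest amalgam. -/
theorem GPCDefined.exists_isFreestAmalgam [M.Finite] [N.Finite] (h : GPCDefined M N) :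
    ∃ P : Matroid α, P.IsFreestAmalgam M N :=
  ⟨_, h.ofFlats_isFreestAmalgam⟩

end GPC

/-- The generalized parallel connection of `M` and `N`: their freest amalgam. -/
noncomputable def genParallelConnection {α : Type*} (M N : Matroid α) [M.Finite] [N.Finite]
    (h : GPCDefined M N) : Matroid α :=
  h.exists_isFreestAmalgam.choose

theorem genParallelConnection_isFreestAmalgam {α : Type*} (M N : Matroid α) [M.Finite] [N.Finite]
    (h : GPCDefined M N) : (genParallelConnection M N h).IsFreestAmalgam M N :=
  h.exists_isFreestAmalgam.choose_spec

theorem genParallelConnection_eq_ofFlats {α : Type*} (M N : Matroid α) [M.Finite] [N.Finite]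
    (h : GPCDefined M N) :
    genParallelConnection M N h = ofFlats (M.E ∪ N.E) (gpcFlat M N) h.flatAxioms := by
  have h1 := genParallelConnection_isFreestAmalgam M N h
  have h2 := h.ofFlats_isFreestAmalgam
  exact ext_indep (by rw [h1.isAmalgam.ground_eq, ofFlats_ground])
    fun I _ => ⟨h2.freest _ h1.isAmalgam I, h1.freest _ h2.isAmalgam I⟩

/-- The flats of the generalized parallel connection of `M(A)` and `N(B)` are the subsets `F` of
`A ∪ B` for which `F ∩ A` is a flat of `M` and `F ∩ B` is a flat of `N`. -/
theorem genParallelConnection_isFlat_iff {α : Type*} (M N : Matroid α) [M.Finite] [N.Finite]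
    (h : GPCDefined M N) (F : Set α) :
    (genParallelConnection M N h).IsFlat F ↔
      F ⊆ M.E ∪ N.E ∧ M.IsFlat (F ∩ M.E) ∧ N.IsFlat (F ∩ N.E) := by
  rw [genParallelConnection_eq_ofFlats]
  exact ofFlats_isFlat_iff h.flatAxioms

end Matroid

namespace Matroid

/-! ### Rank formulas and the two-element criterion for reducibility -/

section Rank

variable {α : Type*} {M N L : Matroid α}

/-! Everything rests on a two-element criterion (`isReducible_iff`): a finite matroid `L` is
reducible exactly when it has distinct elements `u`, `v` such that every set avoiding `v` and
spanning `v` also spans `u`. A loop can serve as `u` and an isthmus as `v`, so an irreducible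
matroid on at least two elements has neither.

In a direct sum, a pair inside one summand behaves as it does in that summand alone. A mixed pair
with `v` in `M` and `u` in `N` is impossible: `M.E \ {v}` spans `v`, since `v` is no isthmus, and it
would have to span `u`, making `u` a loop of `N`.

For `P = P_K(M, N)` and `T = M.E ∩ N.E`, suppose that `u`, `v` witness reducibility. Both in `M`, or
both in `N`, contradicts irreducibility of that restriction of `P`. Otherwise the aim is to find `t
∈ T` in the closure of `{u}`, for `t` can then replace `u` and lies on the same side as `v`. If `u`
is in `M` only, the set `N.E \ {v}` spans `u` in `P`, whence `u ∈ cl_M(T)` and the hypothesis on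
that closure supplies `t`. If `u` is in `N` only, a set spanning `v` is needed whose closure meets
`T` in rank at most one; then `u` is spanned in `N` by a set of rank at most one in `T`. Such a set
exists by modularity of `cl_M(T)` (`GPCDefined.exists_spanning_meet_le_one`), which is the heart of
the proof. -/

theorem eRk_disjointSum (hd : Disjoint M.E N.E) (X : Set α) :
    (M.disjointSum N hd).eRk X = M.eRk X + N.eRk X := by
  obtain ⟨I, hI⟩ := M.exists_isBasis (X ∩ M.E)
  obtain ⟨J, hJ⟩ := N.exists_isBasis (X ∩ N.E)
  have hIJ : (M.disjointSum N hd).IsBasis (I ∪ J) (X ∩ (M.E ∪ N.E)) := by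
    have hIE := hI.indep.subset_ground
    have hJE := hJ.indep.subset_ground
    have hIX := hI.subset
    have hJX := hJ.subset
    have h1 : (I ∪ J) ∩ M.E = I := by
      rw [union_inter_distrib_right, inter_eq_self_of_subset_left hIE,
        (hd.symm.mono_left hJE).inter_eq, union_empty]
    have h2 : (I ∪ J) ∩ N.E = J := by
      rw [union_inter_distrib_right, inter_eq_self_of_subset_left hJE,
        (hd.mono_left hIE).inter_eq, empty_union]
    rw [disjointSum_isBasis_iff, h1, h2, inter_assoc, inter_assoc,
      inter_eq_self_of_subset_right subset_union_left,
      inter_eq_self_of_subset_right subset_union_right]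
    refine ⟨hI, hJ, union_subset (fun x hx => ?_) (fun x hx => ?_), inter_subset_right⟩
    · exact ⟨(hIX hx).1, Or.inl (hIX hx).2⟩
    · exact ⟨(hJX hx).1, Or.inr (hJX hx).2⟩
  have hdis : Disjoint I J := hd.mono hI.indep.subset_ground hJ.indep.subset_ground
  rw [← eRk_inter_ground, disjointSum_ground_eq, ← hIJ.encard_eq_eRk, encard_union_eq hdis,
    hI.encard_eq_eRk, hJ.encard_eq_eRk, eRk_inter_ground, eRk_inter_ground]

theorem eRk_contract_add_eRk (M : Matroid α) {X C : Set α} (hXC : Disjoint X C) :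
    (M.contract C).eRk X + M.eRk C = M.eRk (X ∪ C) := by
  obtain ⟨J, hJ⟩ := M.exists_isBasis' C
  obtain ⟨I, hI, hJI⟩ := hJ.indep.subset_isBasis'_of_subset (hJ.subset.trans subset_union_right)
    (X := X ∪ C)
  -- `J` is already maximal independent in `C`, so extending it to a basis of `X ∪ C` adds nothing
  -- inside `C`.
  have hIC : I ∩ C = J := (hJ.eq_of_subset_indep (hI.indep.subset inter_subset_left)
    (subset_inter hJI hJ.subset) inter_subset_right).symm
  have h1 : (M.contract C).IsBasis' (I \ C) ((X ∪ C) \ C) := by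
    refine hI.contract_isBasis' hJ ?_
    rw [← hIC, sdiff_union_inter]
    exact hI.indep
  rw [union_sdiff_right, hXC.sdiff_eq_left] at h1
  rw [← h1.encard_eq_eRk, ← hJ.encard_eq_eRk, ← hI.encard_eq_eRk, ← hIC,
    encard_sdiff_add_encard_inter]

theorem mem_closure_iff_eRk_insert_eq [L.Finite] {X : Set α} {e : α} (he : e ∈ L.E) :
    e ∈ L.closure X ↔ L.eRk (insert e X) = L.eRk X := by
  constructor
  · intro h
    rw [← eRk_closure_eq, closure_insert_eq_of_mem_closure h, eRk_closure_eq]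
  · intro h
    by_contra hX
    rw [eRk_insert_eq_add_one ⟨he, hX⟩] at h
    obtain ⟨a, ha⟩ := L.exists_eRk_eq X
    rw [ha] at h
    norm_cast at h
    omega

theorem eRk_freeOn_eq (S X : Set α) : (freeOn S).eRk X = (X ∩ S).encard := by
  rw [← eRk_inter_ground, freeOn_ground, eRk_freeOn inter_subset_right]

/-- Contracting `A \ B` lowers the rank of `X` by exactly the order of the lift, so the Higgs term
becomes a rank in `L` itself and both auxiliary matroids disappear. -/
theorem isFreeSeparator_iff (L : Matroid α) {A B : Set α} : L.IsFreeSeparator A B ↔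
    A ∪ B = L.E ∧ ∀ X ⊆ L.E,
      L.eRk X = min (L.eRk (X ∩ A) + (X \ A).encard) (L.eRk (X ∪ (A \ B))) := by
  refine and_congr_right fun hAB => ?_
  have hA : A ⊆ L.E := hAB ▸ subset_union_left
  have hB : B ⊆ L.E := hAB ▸ subset_union_right
  have hE : (L.contractTo B).E = B := by
    simp [contractTo, sdiff_sdiff_right, inter_eq_self_of_subset_right hB]
  have hEB : L.E \ B = A \ B := by rw [← hAB, union_sdiff_right]
  have h1 (X : Set α) (hX : X ⊆ L.E) : ((L.restrict A).adjoinIsthmuses B).eRk X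
      = L.eRk (X ∩ A) + (X \ A).encard := by
    rw [adjoinIsthmuses, eRk_disjointSum, restrict_eRk_eq', eRk_freeOn_eq, restrict_ground_eq]
    congr 2
    ext x
    have := @hX x
    rw [← hAB] at this
    simp only [mem_inter_iff, mem_sdiff, mem_union] at this ⊢
    tauto
  have h2 (X : Set α) (hX : X ⊆ L.E) :
      (L.restrict A).eRk (A \ B) + ((L.contractTo B).adjoinLoops A).eRk X
      = L.eRk (X ∪ (A \ B)) := by
    rw [adjoinLoops, eRk_disjointSum, eRk_loopyOn, add_zero, restrict_eRk_eq _ sdiff_subset,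
      ← eRk_inter_ground _ X, hE, contractTo, add_comm, hEB, eRk_contract_add_eRk]
    · congr 1
      ext x
      have := @hX x
      rw [← hAB] at this
      simp only [mem_inter_iff, mem_sdiff, mem_union] at this ⊢
      tauto
    · exact disjoint_sdiff_right.mono_left inter_subset_right
  constructor
  · rintro ⟨-, -, h⟩ X hX
    have := h X hX
    rwa [restrict_ground_eq, hE, h1 X hX, h2 X hX] at this
  · intro h
    refine ⟨?_, ?_, fun X hX => ?_⟩
    · simp [adjoinIsthmuses, hE, hAB]
    · simp [adjoinLoops, hE, union_comm B, hAB]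
    · rw [restrict_ground_eq, hE, h1 X hX, h2 X hX]
      exact h X hX

/-- A finite matroid is reducible when some element `u` lies in the closure of every set that
spans another element `v` nontrivially. -/
theorem isReducible_iff [L.Finite] : L.IsReducible ↔ ∃ u ∈ L.E, ∃ v ∈ L.E, u ≠ v ∧
    ∀ X ⊆ L.E, v ∉ X → v ∈ L.closure X → u ∈ L.closure X := by
  constructor
  · rintro ⟨A, B, hs, ⟨u, huA, huB⟩, ⟨v, hvB, hvA⟩⟩
    obtain ⟨hAB, h⟩ := L.isFreeSeparator_iff.1 hs
    have hu : u ∈ L.E := hAB ▸ Or.inl huA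
    have hv : v ∈ L.E := hAB ▸ Or.inr hvB
    refine ⟨u, hu, v, hv, fun h' => huB (h' ▸ hvB), fun X hX hvX hcl => ?_⟩
    have h1 := h (insert v X) (insert_subset hv hX)
    rw [(mem_closure_iff_eRk_insert_eq hv).1 hcl] at h1
    rcases min_choice (L.eRk (insert v X ∩ A) + (insert v X \ A).encard)
      (L.eRk (insert v X ∪ (A \ B))) with h2 | h2
    -- The first term of the minimum grows by one when `v ∉ A` is added, and it was already at least
    -- the rank of `X`; so it cannot equal that rank.
    · rw [h2, insert_inter_of_notMem hvA, insert_sdiff_of_notMem _ hvA,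
        encard_insert_of_notMem (fun h' => hvX h'.1)] at h1
      have h3 : L.eRk X ≤ L.eRk (X ∩ A) + (X \ A).encard := by
        conv_lhs => rw [← inter_union_sdiff X A]
        exact L.eRk_union_le_eRk_add_encard _ _
      have hfin : (X \ A).Finite := (L.ground_finite.subset hX).sdiff
      obtain ⟨a, ha⟩ := L.exists_eRk_eq (X ∩ A)
      obtain ⟨b, hb⟩ := L.exists_eRk_eq X
      rw [ha, hb, ← hfin.cast_ncard_eq] at h1 h3
      norm_cast at h1 h3
      omega
    -- Hence adding all of `A \ B`, and with it `u`, leaves the rank of `X` unchanged.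
    · rw [h2] at h1
      rw [mem_closure_iff_eRk_insert_eq hu]
      refine le_antisymm ?_ (L.eRk_mono (subset_insert _ _))
      rw [h1]
      exact L.eRk_mono (insert_subset (Or.inr ⟨huA, huB⟩)
        ((subset_insert _ _).trans subset_union_left))
  · rintro ⟨u, hu, v, hv, huv, h⟩
    -- With this separator the formula reads `r(X) = min (r(X \ v) + |X ∩ v|) (r(X ∪ u))`. The first
    -- term is attained unless `v` lies in `X` and is spanned by the rest of it; in that case `u` is
    -- spanned too and the second term is attained.
    refine ⟨L.E \ {v}, L.E \ {u}, L.isFreeSeparator_iff.2 ⟨?_, fun X hX => ?_⟩,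
      ⟨u, ⟨hu, huv⟩, by simp⟩, ⟨v, ⟨hv, huv.symm⟩, by simp⟩⟩
    · ext x
      simp only [mem_union, mem_sdiff, mem_singleton_iff]
      grind
    · have hAB : (L.E \ {v}) \ (L.E \ {u}) = {u} := by
        ext x
        simp only [mem_sdiff, mem_singleton_iff]
        grind
      have hXA : X ∩ (L.E \ {v}) = X \ {v} := by
        rw [← inter_sdiff_assoc, inter_eq_self_of_subset_left hX]
      have hXA' : X \ (L.E \ {v}) = X ∩ {v} := by
        rw [sdiff_sdiff_right, sdiff_eq_empty.2 hX, empty_union]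
      rw [hAB, hXA, hXA', union_singleton]
      have hle1 : L.eRk X ≤ L.eRk (X \ {v}) + (X ∩ {v}).encard := by
        conv_lhs => rw [← sdiff_union_inter X {v}]
        exact L.eRk_union_le_eRk_add_encard _ _
      refine le_antisymm (le_min hle1 (L.eRk_mono (subset_insert _ _))) ?_
      by_cases hvX : v ∈ X
      · by_cases hcl : v ∈ L.closure (X \ {v})
        · have hu' := L.closure_subset_closure sdiff_subset
            (h _ (sdiff_subset.trans hX) (by simp) hcl)
          rw [(mem_closure_iff_eRk_insert_eq hu).1 hu']
          exact min_le_right _ _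
        · have h1 := eRk_insert_eq_add_one ⟨hv, hcl⟩
          rw [insert_sdiff_singleton, insert_eq_of_mem hvX] at h1
          rw [inter_eq_self_of_subset_right (singleton_subset_iff.2 hvX), encard_singleton, h1]
          exact min_le_left _ _
      · rw [inter_singleton_eq_empty.2 hvX, encard_empty, add_zero, sdiff_singleton_eq_self hvX]
        exact min_le_left _ _

theorem IsIrreducible.not_isLoop [L.Finite] (h : L.IsIrreducible) (hL : 2 ≤ L.E.ncard) (u : α) :
    ¬ L.IsLoop u := by
  intro hu
  obtain ⟨v, hv, hvu⟩ := exists_ne_of_one_lt_ncard hL u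
  exact h (isReducible_iff.2 ⟨u, hu.mem_ground, v, hv, hvu.symm, fun X _ _ _ => hu.mem_closure X⟩)

/-- If `v` is an isthmus, no set avoiding it spans it, so the criterion holds vacuously with any
other element as `u`. -/
theorem IsIrreducible.mem_closure_sdiff [L.Finite] (h : L.IsIrreducible) (hL : 2 ≤ L.E.ncard)
    {v : α} (hv : v ∈ L.E) : v ∈ L.closure (L.E \ {v}) := by
  by_contra hcl
  obtain ⟨u, hu, huv⟩ := exists_ne_of_one_lt_ncard hL v
  exact h (isReducible_iff.2 ⟨u, hu, v, hv, huv, fun X hX hvX hcl' =>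
    (hcl (L.closure_subset_closure (subset_sdiff_singleton hX hvX) hcl')).elim⟩)

end Rank

/-! ### Direct sums -/

section DirectSum

variable {α : Type*} {M N : Matroid α}

theorem disjointSum_finite [M.Finite] [N.Finite] (hd : Disjoint M.E N.E) :
    (M.disjointSum N hd).Finite :=
  ⟨by rw [disjointSum_ground_eq]; exact M.ground_finite.union N.ground_finite⟩

/-- Ranks add, and inserting `e ∈ M.E` does not change the contribution of `N`, which is finite and
cancels. `X` need not lie in `M.E`: rank and closure ignore elements outside the ground set. -/
theorem mem_closure_disjointSum_iff [M.Finite] [N.Finite] (hd : Disjoint M.E N.E) {X : Set α}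
    {e : α} (he : e ∈ M.E) : e ∈ (M.disjointSum N hd).closure X ↔ e ∈ M.closure X := by
  have := disjointSum_finite hd
  rw [mem_closure_iff_eRk_insert_eq (by simp [he]), mem_closure_iff_eRk_insert_eq he,
    eRk_disjointSum, eRk_disjointSum, N.eRk_insert_of_notMem_ground X (hd.notMem_of_mem_left he)]
  obtain ⟨a, ha⟩ := N.exists_eRk_eq X
  rw [ha]
  exact (ENat.add_left_injective_of_ne_top (ENat.natCast_ne_top a)).eq_iff

theorem IsReducible.disjointSum [M.Finite] [N.Finite] (hd : Disjoint M.E N.E)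
    (h : M.IsReducible) : (M.disjointSum N hd).IsReducible := by
  have := disjointSum_finite hd
  obtain ⟨u, hu, v, hv, huv, h⟩ := isReducible_iff.1 h
  refine isReducible_iff.2 ⟨u, by simp [hu], v, by simp [hv], huv, fun X _ hvX hcl => ?_⟩
  rw [mem_closure_disjointSum_iff hd hu, ← closure_inter_ground]
  rw [mem_closure_disjointSum_iff hd hv, ← closure_inter_ground] at hcl
  exact h _ inter_subset_right (fun h' => hvX h'.1) hcl

/-- The asymmetric part of the analysis of a direct sum: the spanned element lies in `M`. -/
theorem isReducible_or_of_disjointSum [M.Finite] [N.Finite] (hM : 2 ≤ M.E.ncard)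
    (hN : 2 ≤ N.E.ncard) (hd : Disjoint M.E N.E) {u v : α} (hv : v ∈ M.E) (hu : u ∈ M.E ∪ N.E)
    (huv : u ≠ v) (h : ∀ X ⊆ M.E ∪ N.E, v ∉ X → v ∈ (M.disjointSum N hd).closure X →
      u ∈ (M.disjointSum N hd).closure X) : M.IsReducible ∨ N.IsReducible := by
  by_contra! hcon
  obtain ⟨hMi, hNi⟩ : M.IsIrreducible ∧ N.IsIrreducible := hcon
  rcases hu with hu | hu
  · refine hMi (isReducible_iff.2 ⟨u, hu, v, hv, huv, fun X hX hvX hcl => ?_⟩)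
    rw [← mem_closure_disjointSum_iff hd hv] at hcl
    exact (mem_closure_disjointSum_iff hd hu).1 (h X (hX.trans subset_union_left) hvX hcl)
  -- A set inside `M.E` spans in `N` only the loops of `N`.
  · have h1 := h (M.E \ {v}) (sdiff_subset.trans subset_union_left) (by simp)
      ((mem_closure_disjointSum_iff hd hv).2 (hMi.mem_closure_sdiff hM hv))
    rw [disjointSum_comm, mem_closure_disjointSum_iff hd.symm hu, ← closure_inter_ground,
      (hd.mono_left sdiff_subset).inter_eq, closure_empty] at h1
    exact hNi.not_isLoop hN u h1

theorem isIrreducible_disjointSum_iff [M.Finite] [N.Finite] (hM : 2 ≤ M.E.ncard)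
    (hN : 2 ≤ N.E.ncard) (hd : Disjoint M.E N.E) :
    (M.disjointSum N hd).IsIrreducible ↔ M.IsIrreducible ∧ N.IsIrreducible := by
  have := disjointSum_finite hd
  constructor
  · refine fun h => ⟨fun h' => h (h'.disjointSum hd), fun h' => h ?_⟩
    rw [disjointSum_comm]
    exact h'.disjointSum hd.symm
  · rintro ⟨hMi, hNi⟩ h
    obtain ⟨u, hu, v, hv, huv, h⟩ := isReducible_iff.1 h
    rw [disjointSum_ground_eq] at hu hv h
    rcases hv with hv | hv
    · exact (isReducible_or_of_disjointSum hM hN hd hv hu huv h).elim hMi hNi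
    · rw [disjointSum_comm, union_comm] at h
      exact (isReducible_or_of_disjointSum hN hM hd.symm hv hu.symm huv h).elim hNi hMi

end DirectSum

end Matroid

namespace Matroid

/-! ### Spanning sets that meet the modular flat in small rank -/

section Parallel

variable {α : Type*} {M N L : Matroid α}

theorem IsNonloop.exists_mem_closure_singleton {u : α} {S : Set α} (hu : L.IsNonloop u)
    (hS : S ⊆ L.E) (hr : L.eRk S ≤ 1) (huS : u ∈ L.closure S) : ∃ t ∈ S, t ∈ L.closure {u} := by
  obtain ⟨J, hJ⟩ := L.exists_isBasis S
  rw [← hJ.closure_eq_closure] at huS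
  rw [← hJ.encard_eq_eRk, encard_le_one_iff_subsingleton] at hr
  rcases hr.eq_empty_or_singleton with rfl | ⟨t, rfl⟩
  · rw [closure_empty] at huS
    exact (hu.not_isLoop huS).elim
  · exact ⟨t, hJ.subset rfl, hu.mem_closure_singleton huS⟩

theorem IsCircuit.mem_closure_singleton_of_pair {e f : α} (hef : e ≠ f)
    (hc : L.IsCircuit {e, f}) : f ∈ L.closure {e} := by
  have := hc.mem_closure_sdiff_singleton_of_mem (e := f) (by simp)
  rwa [pair_sdiff_right hef] at this

theorem GPCDefined.eRk_eq (h : GPCDefined M N) {S : Set α} (hS : S ⊆ M.E ∩ N.E) :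
    M.eRk S = N.eRk S := by
  rw [← restrict_eRk_eq M hS, h.restrict_eq, restrict_eRk_eq N hS]

/-- If `T` is modular up to parallel elements and `v ∉ T` is not a coloop, some set spanning `v`
nontrivially meets `T` in rank at most one. -/
theorem GPCDefined.exists_spanning_meet_le_one [M.Finite] (h : GPCDefined M N)
    (hloop : ∀ x, ¬ M.IsLoop x) {v : α} (hv : v ∈ M.E) (hvN : v ∉ N.E)
    (hvcl : v ∈ M.closure (M.E \ {v})) :
    ∃ X ⊆ M.E, v ∉ X ∧ v ∈ M.closure X ∧ M.eRk (M.closure X ∩ (M.E ∩ N.E)) ≤ 1 := by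
  set T := M.E ∩ N.E with hT
  have hvT : v ∉ T := fun h' => hvN h'.2
  have hTE : T ⊆ M.E := inter_subset_left
  by_cases hvclT : v ∈ M.closure T
  · rcases h.loop_or_parallel v ⟨hvclT, hvT⟩ with hl | ⟨t, ht, hc⟩
    · exact (hloop v hl).elim
    have hvt : v ≠ t := fun h' => hvT (h' ▸ ht)
    refine ⟨{t}, singleton_subset_iff.2 ht.1, hvt, ?_, ?_⟩
    · rw [pair_comm] at hc
      exact hc.mem_closure_singleton_of_pair hvt.symm
    · refine (M.eRk_mono inter_subset_left).trans ?_
      rw [eRk_closure_eq]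
      exact M.eRk_singleton_le t
  obtain ⟨J, hJ⟩ := M.exists_isBasis T
  have hvJ : v ∉ M.closure J := by rwa [hJ.closure_eq_closure]
  obtain ⟨B, hB, hJB⟩ := (hJ.indep.insert_indep_iff.2 (Or.inl ⟨hv, hvJ⟩)).exists_isBase_superset
  have hvB : v ∈ B := hJB (mem_insert _ _)
  have hJB' : J ⊆ B := (subset_insert _ _).trans hJB
  -- `insert v I'` is the part of the basis `B` complementary to the basis `J` of `T`; by modularity
  -- its closure meets `T` in rank zero.
  set I' := (B \ J) \ {v} with hI'
  have hBeq : insert v I' ∪ J = B := by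
    ext x
    have h1 := @hJB' x
    simp only [hI', mem_union, mem_insert_iff, mem_sdiff, mem_singleton_iff]
    grind
  have hdisj : Disjoint (insert v I') J := by
    rw [disjoint_left]
    rintro x (rfl | hx) hxJ
    · exact hvT (hJ.subset hxJ)
    · exact hx.1.2 hxJ
  have hvI' : v ∉ I' := fun h' => h'.2 rfl
  have hBE := hB.subset_ground
  have hIE : insert v I' ⊆ M.E := (hBeq ▸ subset_union_left).trans hBE
  have hI'E : I' ⊆ M.E := (subset_insert _ _).trans hIE
  have hIindep : M.Indep (insert v I') := hB.indep.subset (hBeq ▸ subset_union_left)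
  -- the meet of a one-element extension with `T`
  have hmeet (e : α) (he : e ∈ M.E) :
      M.eRk (insert e (insert v I')) =
        (insert v I').encard + M.eRk (M.closure (insert e (insert v I')) ∩ T) := by
    -- Modularity of `T` against this flat: the join has full rank `|B| = |insert v I'| + |J|`, and
    -- `T` has rank `|J|`, which cancels.
    have h1 := h.eRk_add (M.isFlat_closure (insert e (insert v I')))
    rw [← hT] at h1
    have h2 : M.eRk (M.closure (insert e (insert v I')) ∪ T) = B.encard := by
      rw [hB.encard_eq_eRank, ← eRk_closure_eq]
      have : M.closure (M.closure (insert e (insert v I')) ∪ T) = M.E := by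
        rw [closure_union_closure_left_eq]
        refine (M.closure_subset_ground _).antisymm ?_
        rw [← hB.closure_eq]
        refine M.closure_subset_closure ?_
        rw [← hBeq]
        exact union_subset_union (subset_insert _ _) hJ.subset
      rw [this, eRk_ground]
    rw [h2, eRk_closure_eq, ← hJ.encard_eq_eRk, ← hBeq, encard_union_eq hdisj] at h1
    have hJfin : J.encard ≠ ⊤ := (M.ground_finite.subset (hJB'.trans hBE)).encard_lt_top.ne
    have h3 : J.encard + M.eRk (insert e (insert v I')) =
        J.encard + ((insert v I').encard +
          M.eRk (M.closure (insert e (insert v I')) ∩ T)) := by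
      rw [h1]; ring
    exact ENat.add_right_injective_of_ne_top hJfin h3
  have hIfin : (insert v I').encard ≠ ⊤ := (M.ground_finite.subset hIE).encard_lt_top.ne
  by_contra! hcon
  -- otherwise `v` is a coloop of each one-element extension
  have hcoloop (e : α) (he : e ∈ M.E) :
      v ∉ M.closure (M.closure (insert e (insert v I')) \ {v}) := by
    intro hcl
    refine (hcon _ (sdiff_subset.trans (M.closure_subset_ground _)) (by simp) hcl).not_ge ?_
    have h1 : M.eRk (M.closure (insert e (insert v I')) ∩ T) ≤ 1 := by
      have h2 := M.eRk_insert_le_add_one e (insert v I')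
      rw [hmeet e he, hIindep.eRk_eq_encard] at h2
      exact (ENat.add_le_add_iff_left hIfin).1 h2
    refine (M.eRk_mono (inter_subset_inter_left _ ?_)).trans h1
    exact (M.closure_subset_closure sdiff_subset).trans (M.closure_closure _).subset
  -- The goal is to make `v` an isthmus of `M`: everything else lies in the closure of `B \ {v} = I'
  -- ∪ J`.
  have hspan : M.E \ {v} ⊆ M.closure (I' ∪ J) := by
    rintro e ⟨he, hev⟩
    have hsub : insert e I' ⊆ M.closure (insert e (insert v I')) \ {v} := by
      refine subset_sdiff_singleton ?_ ?_
      · exact (insert_subset_insert (subset_insert _ _)).trans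
          (M.subset_closure _ (insert_subset he hIE))
      · rintro (h' | h')
        · exact hev h'.symm
        · exact hvI' h'
    have hvn : v ∉ M.closure (insert e I') :=
      fun h' => hcoloop e he (M.closure_subset_closure hsub h')
    by_cases heI' : e ∈ M.closure I'
    · exact M.closure_subset_closure subset_union_left heI'
    have heI : e ∉ M.closure (insert v I') := fun h' => hvn (closure_exchange ⟨h', heI'⟩).1
    -- Here `e` raises the rank of `insert v I'`, so by `hmeet` the extended flat meets `T` in rank
    -- exactly one.
    have hne : M.closure (insert e (insert v I')) ∩ T ≠ ∅ := by
      intro h0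
      have h1 := hmeet e he
      rw [h0, eRk_empty, eRk_insert_eq_add_one ⟨he, heI⟩, hIindep.eRk_eq_encard] at h1
      exact one_ne_zero (ENat.add_right_injective_of_ne_top hIfin h1)
    obtain ⟨t, ht, htT⟩ := nonempty_iff_ne_empty.2 hne
    have hti : t ∉ M.closure I' := by
      intro htI'
      have htJ : t ∈ M.closure J := by
        rw [hJ.closure_eq_closure]
        exact M.mem_closure_of_mem htT
      -- Disjoint parts of an independent set have closures meeting only in loops, and `M` has none.
      have hind : M.Indep (I' ∪ J) :=
        hB.indep.subset (hBeq ▸ union_subset_union_left _ (subset_insert _ _))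
      have h1 : t ∈ M.closure I' ∩ M.closure J := ⟨htI', htJ⟩
      rw [← hind.closure_inter_eq_inter_closure,
        (hdisj.mono_left (subset_insert _ _)).inter_eq, closure_empty] at h1
      exact hloop t h1
    have htv : t ≠ v := fun h' => hvT (h' ▸ htT)
    -- If not, exchange would put `v` in the closure of `I'` with `e` and `t`, all in the extended
    -- flat without `v`, contrary to `hcoloop`.
    have hte : t ∈ M.closure (insert e I') := by
      by_contra htn
      rw [insert_comm] at ht
      have h1 := (closure_exchange ⟨ht, htn⟩).1
      rw [insert_comm] at ht
      have h2 : t ∈ M.closure (insert e (insert v I')) \ {v} := ⟨ht, htv⟩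
      exact hcoloop e he (M.closure_subset_closure (insert_subset h2 hsub) h1)
    -- Since `t` is spanned by `I'` with `e` but not by `I'`, exchange gives `e` in the closure of
    -- `I'` with `t ∈ T`.
    have h2 := (closure_exchange ⟨hte, hti⟩).1
    have h3 : insert t I' ⊆ M.closure (I' ∪ J) := by
      refine insert_subset ?_ ((M.subset_closure _ hI'E).trans
        (M.closure_subset_closure subset_union_left))
      refine M.closure_subset_closure subset_union_right ?_
      rw [hJ.closure_eq_closure]
      exact M.mem_closure_of_mem htT
    exact M.closure_subset_closure_of_subset_closure h3 h2
  have h1 := M.closure_subset_closure_of_subset_closure hspan hvcl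
  refine hB.indep.notMem_closure_sdiff_of_mem hvB (M.closure_subset_closure ?_ h1)
  refine subset_sdiff_singleton ?_ ?_
  · rw [← hBeq]
    exact union_subset_union_left _ (subset_insert _ _)
  · rintro (h' | h')
    · exact hvI' h'
    · exact hvT (hJ.subset h')

end Parallel

/-! ### Closures and irreducibility of the generalized parallel connection -/

section GPC

variable {α : Type*} {M N : Matroid α} [M.Finite] [N.Finite]

theorem genParallelConnection_ground (h : GPCDefined M N) :
    (genParallelConnection M N h).E = M.E ∪ N.E :=
  (genParallelConnection_isFreestAmalgam M N h).isAmalgam.ground_eq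

theorem genParallelConnection_closure_inter_left (h : GPCDefined M N) {X : Set α}
    (hX : X ⊆ M.E) : (genParallelConnection M N h).closure X ∩ M.E = M.closure X := by
  conv_rhs => rw [← (genParallelConnection_isFreestAmalgam M N h).isAmalgam.restrict_left]
  rw [restrict_closure_eq _ hX (by simp [genParallelConnection_ground])]

theorem genParallelConnection_closure_inter_right (h : GPCDefined M N) {X : Set α}
    (hX : X ⊆ N.E) : (genParallelConnection M N h).closure X ∩ N.E = N.closure X := by
  conv_rhs => rw [← (genParallelConnection_isFreestAmalgam M N h).isAmalgam.restrict_right]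
  rw [restrict_closure_eq _ hX (by simp [genParallelConnection_ground])]

theorem genParallelConnection_closure_subset (h : GPCDefined M N) {X G H : Set α}
    (hG : M.IsFlat G) (hH : N.IsFlat H) (hGH : G ∩ (M.E ∩ N.E) = H ∩ (M.E ∩ N.E))
    (hX : X ⊆ G ∪ H) : (genParallelConnection M N h).closure X ⊆ G ∪ H := by
  have hfl := (genParallelConnection_isFlat_iff M N h _).2 (gpcFlat_union hG hH hGH).1
  exact (closure_subset_closure _ hX).trans hfl.closure.subset

/-- The right-hand side is a flat of the connection, since its two pieces agree on `T`. A set in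
`M.E` thus spans elements outside `M` only through the trace of its `M`-closure on `T`. -/
theorem genParallelConnection_closure_subset_left (h : GPCDefined M N) {X : Set α}
    (hX : X ⊆ M.E) : (genParallelConnection M N h).closure X ⊆
      M.closure X ∪ N.closure (M.closure X ∩ (M.E ∩ N.E)) := by
  refine genParallelConnection_closure_subset h (M.isFlat_closure _) (N.isFlat_closure _) ?_
    ((M.subset_closure X hX).trans subset_union_left)
  rw [← h.closure_eq inter_subset_right]
  refine Subset.antisymm (subset_inter ?_ inter_subset_right) (inter_subset_inter_left _ ?_)
  · exact M.subset_closure _ (inter_subset_right.trans inter_subset_left)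
  · exact (M.closure_subset_closure inter_subset_left).trans (M.closure_closure X).subset

theorem genParallelConnection_closure_subset_right (h : GPCDefined M N) {X : Set α}
    (hX : X ⊆ N.E) : (genParallelConnection M N h).closure X ⊆
      M.closure (N.closure X ∩ (M.E ∩ N.E)) ∪ N.closure X := by
  refine genParallelConnection_closure_subset h (M.isFlat_closure _) (N.isFlat_closure _) ?_
    ((N.subset_closure X hX).trans subset_union_right)
  rw [h.closure_eq inter_subset_right]
  refine Subset.antisymm (inter_subset_inter_left _ ?_) (subset_inter ?_ inter_subset_right)
  · exact (N.closure_subset_closure inter_subset_left).trans (N.closure_closure X).subset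
  · exact N.subset_closure _ (inter_subset_right.trans inter_subset_right)

theorem genParallelConnection_isIrreducible (h : GPCDefined M N) (hM : 2 ≤ M.E.ncard)
    (hN : 2 ≤ N.E.ncard) (hMi : M.IsIrreducible) (hNi : N.IsIrreducible) :
    (genParallelConnection M N h).IsIrreducible := by
  set P := genParallelConnection M N h
  have hPE : P.E = M.E ∪ N.E := genParallelConnection_ground h
  have : P.Finite := ⟨hPE ▸ M.ground_finite.union N.ground_finite⟩
  intro hred
  obtain ⟨u, hu, v, hv, huv, hspan⟩ := isReducible_iff.1 hred
  rw [hPE] at hu hv hspan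
  have hML {X : Set α} (hX : X ⊆ M.E) : P.closure X ∩ M.E = M.closure X :=
    genParallelConnection_closure_inter_left h hX
  have hNR {X : Set α} (hX : X ⊆ N.E) : P.closure X ∩ N.E = N.closure X :=
    genParallelConnection_closure_inter_right h hX
  have hML' {X : Set α} (hX : X ⊆ M.E) : M.closure X ⊆ P.closure X :=
    (hML hX).symm.subset.trans inter_subset_left
  have hNR' {X : Set α} (hX : X ⊆ N.E) : N.closure X ⊆ P.closure X :=
    (hNR hX).symm.subset.trans inter_subset_left
  have hspanM {X : Set α} (hX : X ⊆ M.E) (hvX : v ∉ X) (hcl : v ∈ M.closure X) :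
      u ∈ P.closure X := hspan X (hX.trans subset_union_left) hvX (hML' hX hcl)
  have hspanN {X : Set α} (hX : X ⊆ N.E) (hvX : v ∉ X) (hcl : v ∈ N.closure X) :
      u ∈ P.closure X := hspan X (hX.trans subset_union_right) hvX (hNR' hX hcl)
  by_cases hM' : u ∈ M.E ∧ v ∈ M.E
  · refine hMi (isReducible_iff.2 ⟨u, hM'.1, v, hM'.2, huv, fun X hX hvX hcl => ?_⟩)
    rw [← hML hX]
    exact ⟨hspanM hX hvX hcl, hM'.1⟩
  by_cases hN' : u ∈ N.E ∧ v ∈ N.E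
  · refine hNi (isReducible_iff.2 ⟨u, hN'.1, v, hN'.2, huv, fun X hX hvX hcl => ?_⟩)
    rw [← hNR hX]
    exact ⟨hspanN hX hvX hcl, hN'.1⟩
  by_cases hvM : v ∈ M.E
  · have huM : u ∉ M.E := fun h' => hM' ⟨h', hvM⟩
    have huN : u ∈ N.E := hu.resolve_left huM
    have hvN : v ∉ N.E := fun h' => hN' ⟨huN, h'⟩
    -- An arbitrary set spanning `v` could meet `T` in large rank and span `u` without giving a
    -- single `t ∈ T` in the closure of `{u}`.
    obtain ⟨X, hX, hvX, hcl, hr⟩ := h.exists_spanning_meet_le_one (hMi.not_isLoop hM) hvM hvN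
      (hMi.mem_closure_sdiff hM hvM)
    have hu1 : u ∈ N.closure (M.closure X ∩ (M.E ∩ N.E)) :=
      (genParallelConnection_closure_subset_left h hX (hspanM hX hvX hcl)).resolve_left
        fun h' => huM (M.mem_ground_of_mem_closure h')
    rw [h.eRk_eq inter_subset_right] at hr
    obtain ⟨t, ht, htu⟩ := (isNonloop_of_not_isLoop huN
      (hNi.not_isLoop hN u)).exists_mem_closure_singleton
      (inter_subset_right.trans inter_subset_right) hr hu1
    -- Every set spanning `u` in `P` spans `t`, so `t` and `v` satisfy the criterion inside `M`.
    refine hMi (isReducible_iff.2 ⟨t, ht.2.1, v, hvM, fun h' => hvN (h' ▸ ht.2.2),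
      fun Y hY hvY hcl' => ?_⟩)
    rw [← hML hY]
    refine ⟨P.closure_subset_closure_of_subset_closure
      (singleton_subset_iff.2 (hspanM hY hvY hcl')) ?_, ht.2.1⟩
    exact hNR' (singleton_subset_iff.2 huN) htu
  · have hvN : v ∈ N.E := hv.resolve_left hvM
    have huN : u ∉ N.E := fun h' => hN' ⟨h', hvN⟩
    have huM : u ∈ M.E := hu.resolve_right huN
    -- No careful choice of set is needed on this side: `u ∈ cl_M(T)` alone forces `u` to be
    -- parallel to an element of `T`.
    have hu1 : u ∈ M.closure (N.closure (N.E \ {v}) ∩ (M.E ∩ N.E)) :=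
      (genParallelConnection_closure_subset_right h sdiff_subset (hspanN sdiff_subset (by simp)
        (hNi.mem_closure_sdiff hN hvN))).resolve_right
        fun h' => huN (N.mem_ground_of_mem_closure h')
    have hu2 : u ∈ M.closure (M.E ∩ N.E) := M.closure_subset_closure inter_subset_right hu1
    rcases h.loop_or_parallel u ⟨hu2, fun h' => huN h'.2⟩ with hl | ⟨t, ht, hc⟩
    · exact hMi.not_isLoop hM u hl
    have hut : u ≠ t := fun h' => huN (h' ▸ ht.2)
    have htu := hc.mem_closure_singleton_of_pair hut
    refine hNi (isReducible_iff.2 ⟨t, ht.2, v, hvN, fun h' => hvM (h' ▸ ht.1),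
      fun Y hY hvY hcl' => ?_⟩)
    rw [← hNR hY]
    refine ⟨P.closure_subset_closure_of_subset_closure
      (singleton_subset_iff.2 (hspanN hY hvY hcl')) ?_, ht.2⟩
    exact hML' (singleton_subset_iff.2 huM) htu

end GPC

end Matroid

theorem proposition5p3 {α : Type*} (M N : Matroid α) [M.Finite] [N.Finite]
    (hM : 2 ≤ M.E.ncard) (hN : 2 ≤ N.E.ncard) :
    (∀ h : Matroid.GPCDefined M N, M.IsIrreducible → N.IsIrreducible →
      (Matroid.genParallelConnection M N h).IsIrreducible) ∧
    (∀ hdisj : Disjoint M.E N.E,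
      (M.disjointSum N hdisj).IsIrreducible ↔ M.IsIrreducible ∧ N.IsIrreducible) :=
  ⟨fun h hMi hNi => Matroid.genParallelConnection_isIrreducible h hM hN hMi hNi,
    fun hdisj => Matroid.isIrreducible_disjointSum_iff hM hN hdisj⟩
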